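/- For $n\ge 0$ let $Q_n$ be the Boolean lattice of dimension $n$, i.e. the set of all subsets of an $n$-element set ordered by inclusion. A blue/red coloring of a poset assigns to each of its elements one of the colors blue and red. A copy of a colored poset $\dot P$ (a poset $P$ with a fixed blue/red coloring) in a colored poset $Q$ is the image of a map $\phi\colon P\to Q$ such that $X\le_P Y\iff \phi(X)\le_Q\phi(Y)$ for all $X,Y\in P$, and $\phi(X)$ has the same color as $X$ for every $X\in P$. A blue (red) copy of an uncolored poset is a copy of this poset with all elements colored blue (red). The poset Erdős–Hajnal number $\widetilde R(\dot P,Q_n)$ is the smallest $N$ such that every blue/red coloring of $Q_N$ contains a copy of $\dot P$, a blue copy of $Q_n$, or a red copy of $Q_n$. The poset Ramsey number $R(P,Q)$ of posets $P,Q$ is the smallest $N$ such that every blue/red coloring of $Q_N$ contains a blue copy of $P$ or a red copy of $Q$. Let $\dot C_t^{(rbr)}$ be the red-alternating chain of length $t$, i.e. the chain $Z_1<\dots<Z_t$ on $t$ elements colored alternatingly red and blue, with the minimal element $Z_1$ red. **Theorem.** 1. For every $n$, $\widetilde R(\dot C_2^{(rbr)},Q_n)=\widetilde R(\dot C_3^{(rbr)},Q_n)=2n$.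 2. There is an $n_0$ such that for all $t\ge 4$ and all $n\ge n_0$, $$2.02\,n<\widetilde R(\dot C_t^{(rbr)},Q_n)\le (t-1)n.$$ 3. There is an $n_0$ such that $R(Q_n,Q_n)>2.02\,n$ for all $n\ge n_0$. -/

import Mathlib

/-- The two colors. -/
inductive Color : Type
  | blue
  | red

/-- The Boolean lattice of dimension `n`: all subsets of an `n`-element ground set, ordered by
inclusion. -/
abbrev BooleanLattice (n : ℕ) : Type := Finset (Fin n)

/-- Let `cP` and `cQ` be blue/red colorings of the posets `P` and `Q`. The colored poset `(Q, cQ)`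
contains a (colored, induced) copy of the colored poset `(P, cP)`: there is a map `φ : P → Q` with
`x ≤ y ↔ φ x ≤ φ y` that preserves colors. -/
def HasColoredCopy {P Q : Type*} [PartialOrder P] [PartialOrder Q]
    (cP : P → Color) (cQ : Q → Color) : Prop :=
  ∃ φ : P ↪o Q, ∀ x : P, cQ (φ x) = cP x

/-- The monochromatic coloring of `P` with color `a`. -/
def monoColoring (P : Type*) (a : Color) : P → Color := fun _ => a

/-- The poset Ramsey number `R(P, Q)`: the smallest `N` such that every blue/red coloring of the
`N`-dimensional Boolean lattice contains a blue induced copy of `P` or a red induced copy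
of `Q`. -/
noncomputable def posetRamsey (P Q : Type*) [PartialOrder P] [PartialOrder Q] : ℕ :=
  sInf {N : ℕ | ∀ c : BooleanLattice N → Color,
    HasColoredCopy (monoColoring P Color.blue) c ∨ HasColoredCopy (monoColoring Q Color.red) c}

/-- The poset Erdős–Hajnal number of a colored poset `(P, cP)` versus `Q_n`: the smallest `N` such
that every blue/red coloring of the `N`-dimensional Boolean lattice contains a copy of `(P, cP)`, a
blue copy of `Q_n`, or a red copy of `Q_n`. -/
noncomputable def posetErdosHajnal {P : Type*} [PartialOrder P] (cP : P → Color) (n : ℕ) : ℕ :=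
  sInf {N : ℕ | ∀ c : BooleanLattice N → Color,
    HasColoredCopy cP c ∨
    HasColoredCopy (monoColoring (BooleanLattice n) Color.blue) c ∨
    HasColoredCopy (monoColoring (BooleanLattice n) Color.red) c}

/-- The coloring of the red-alternating chain of length `t`: the underlying poset is the chain
`Fin t` on `t` vertices, colored alternatingly, with red minimal vertex `0`. -/
def redAlternatingChain (t : ℕ) : Fin t → Color :=
  fun i => if Even (i : ℕ) then Color.red else Color.blue

/-
A copy of `Q_n` in `Q_N` is, up to isomorphism, a monotone map `f` with `f S ∩ X = S` for all
`S ⊆ X`, where `X` is a fixed set of `n` points. In a coloring without monochromatic copies of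
`Q_n`, every `n`-dimensional interval therefore contains both colors, so each further block of `n`
points prolongs an alternating chain by one element. The first two blocks together give three
elements, because raising the sets `S` that already lie above a set of the wanted color by the
whole second block again produces a copy of `Q_n`. This yields the upper bounds `(t - 1) n`. The
lower bound `2 n` comes from coloring the layers from `n` on red.

For the lower bound `2.02 n` take `N = 4r + d` and `n = 2r` with `r = 16m`, `d = m`. Color the
layers below `r` blue, those above `3r + d` red, and a set in between red if and only if it lies
below a member of a family `H` in layer `2r + d`. No such coloring contains a red-alternating chain
of length four. A blue copy of `Q_n` starts at a set of size at most `r + d`, a red one at a set of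
size at least `r`. The first is impossible if `H` meets the middle layer of every `2r`-dimensional
interval starting in layer `r + d`, the second if every such interval starting in layer `r` has in
its middle layer a set below no member of `H`. A random `H` of density `p = 2 ^ (-20m)` has both
properties: the middle layer of an interval has exponentially more than `1 / p` elements, and it
contains eleven sets whose sets of supersets in layer `2r + d` are pairwise disjoint, so that all of
these are hit with probability at most the eleventh power of a small number.
-/

open MeasureTheory ProbabilityTheory
open scoped Finset

namespace Color

/-- The color different from a given one. -/
def other : Color → Color
  | blue => red
  | red => blue

theorem eq_other_of_ne {a b : Color} (h : a ≠ b) : a = b.other := by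
  cases a <;> cases b <;> simp_all [other]

end Color

section Copies

variable {P P' Q Q' R R' : Type*} [PartialOrder P] [PartialOrder P'] [PartialOrder Q]
  [PartialOrder Q'] [PartialOrder R] [PartialOrder R']

theorem HasColoredCopy.trans {cP : P → Color} {cQ : Q → Color} {cR : R → Color}
    (h : HasColoredCopy cP cQ) (h' : HasColoredCopy cQ cR) : HasColoredCopy cP cR := by
  obtain ⟨φ, hφ⟩ := h
  obtain ⟨ψ, hψ⟩ := h'
  exact ⟨φ.trans ψ, fun x => (hψ (φ x)).trans (hφ x)⟩

theorem hasColoredCopy_comp (ψ : Q ↪o Q') (c : Q' → Color) : HasColoredCopy (c ∘ ψ) c :=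
  ⟨ψ, fun _ => rfl⟩

/-- Every coloring of `Q` contains a copy of the colored poset `(P, cP)` or a monochromatic copy
of `R`. The number `posetErdosHajnal cP n` is the least `N` for which this holds with `Q = Q_N` and
`R = Q_n`; allowing arbitrary posets lets one change the ground sets freely. -/
def ErdosHajnalArrow (Q : Type*) [PartialOrder Q] (cP : P → Color) (R : Type*)
    [PartialOrder R] : Prop :=
  ∀ c : Q → Color, HasColoredCopy cP c ∨ ∃ a, HasColoredCopy (monoColoring R a) c

theorem ErdosHajnalArrow.mono {cP : P → Color} {cP' : P' → Color} (h : ErdosHajnalArrow Q cP R)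
    (ψ : Q ↪o Q') (hP : HasColoredCopy cP' cP) (ρ : R' ↪o R) : ErdosHajnalArrow Q' cP' R' := by
  intro c
  refine (h (c ∘ ψ)).imp (fun hc => hP.trans (hc.trans (hasColoredCopy_comp ψ c))) ?_
  rintro ⟨a, ha⟩
  exact ⟨a, (hasColoredCopy_comp ρ (monoColoring R a)).trans (ha.trans (hasColoredCopy_comp ψ c))⟩

theorem ErdosHajnalArrow.of_monoColoring {a : Color}
    (h : ErdosHajnalArrow Q (monoColoring R a) R) (cP : P → Color) : ErdosHajnalArrow Q cP R :=
  fun c => Or.inr ((h c).elim (fun ha => ⟨a, ha⟩) id)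

theorem posetErdosHajnal_eq_sInf (cP : P → Color) (n : ℕ) :
    posetErdosHajnal cP n =
      sInf {N | ErdosHajnalArrow (BooleanLattice N) cP (BooleanLattice n)} := by
  refine congrArg sInf (Set.ext fun N => forall_congr' fun c => or_congr_right ⟨?_, ?_⟩)
  · rintro (h | h)
    exacts [⟨_, h⟩, ⟨_, h⟩]
  · rintro ⟨_ | _, h⟩
    exacts [Or.inl h, Or.inr h]

theorem posetErdosHajnal_le {cP : P → Color} {n N : ℕ}
    (h : ErdosHajnalArrow (BooleanLattice N) cP (BooleanLattice n)) :
    posetErdosHajnal cP n ≤ N := by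
  rw [posetErdosHajnal_eq_sInf]
  exact Nat.sInf_le h

theorem posetRamsey_self (n : ℕ) :
    posetRamsey (BooleanLattice n) (BooleanLattice n) =
      posetErdosHajnal (monoColoring (BooleanLattice n) Color.blue) n := by
  simp only [posetRamsey, posetErdosHajnal, or_self_left]

end Copies

section BooleanLattice

variable {α ι P : Type*}

theorem exists_injective_mem_iff_mem [Finite ι] (φ : Finset ι ↪o Finset α) :
    ∃ x : ι → α, Function.Injective x ∧ ∀ S i, x i ∈ φ S ↔ i ∈ S := by
  classical
  cases nonempty_fintype ι
  have h : ∀ i : ι, ∃ x, x ∈ φ {i} ∧ x ∉ φ {i}ᶜ := fun i =>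
    Finset.not_subset.1 fun h => by simpa using φ.le_iff_le.1 h
  choose x hx hx' using h
  have key : ∀ S i, x i ∈ φ S ↔ i ∈ S := by
    refine fun S i => ⟨fun hi => ?_, fun hi =>
      φ.monotone (Finset.singleton_subset_iff.2 hi) (hx i)⟩
    by_contra hiS
    exact hx' i (φ.monotone (Finset.subset_compl_singleton.2 hiS) hi)
  refine ⟨x, fun i j hij => ?_, key⟩
  exact (Finset.mem_singleton.1 ((key {j} i).1 (hij ▸ hx j)))

variable [DecidableEq α] [Fintype ι] {c : Finset α → Color} {a : Color} {A X Y : Finset α}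

/-- From a copy `φ` one gets `X` by picking, for each `i`, an element of `φ {i}` outside
`φ {i}ᶜ`. -/
theorem hasColoredCopy_mono_iff :
    HasColoredCopy (monoColoring (Finset ι) a) c ↔
      ∃ X : Finset α, #X = Fintype.card ι ∧ ∃ f : Finset α → Finset α, Monotone f ∧
        ∀ S ⊆ X, f S ∩ X = S ∧ c (f S) = a := by
  classical
  constructor
  · rintro ⟨φ, hφ⟩
    obtain ⟨x, hx, hmem⟩ := exists_injective_mem_iff_mem φ
    refine ⟨Finset.univ.image x, Finset.card_image_of_injective _ hx,
      fun S => φ {i | x i ∈ S}, fun S T hST => ?_, fun S hS => ⟨?_, hφ _⟩⟩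
    · exact φ.monotone (Finset.monotone_filter_right _ fun i _ hi => hST hi)
    · ext y
      simp only [Finset.mem_inter, Finset.mem_image, Finset.mem_univ, true_and]
      constructor
      · rintro ⟨hy, i, rfl⟩
        simpa [hmem] using hy
      · intro hy
        obtain ⟨i, -, rfl⟩ := Finset.mem_image.1 (hS hy)
        exact ⟨by simpa [hmem] using hy, i, rfl⟩
  · rintro ⟨X, hX, f, hf, hfX⟩
    let e : ι ↪ α :=
      (Fintype.equivOfCardEq (by simp [hX] : Fintype.card ι = Fintype.card X)).toEmbedding.trans
        (Function.Embedding.subtype _)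
    have heX : ∀ S : Finset ι, S.map e ⊆ X := fun S y hy => by
      obtain ⟨i, -, rfl⟩ := Finset.mem_map.1 hy
      exact Subtype.coe_prop _
    refine ⟨OrderEmbedding.ofMapLEIff (fun S => f (S.map e)) fun S T => ⟨fun h => ?_, fun h =>
      hf (Finset.map_subset_map.2 h)⟩, fun S => (hfX _ (heX S)).2⟩
    have h' := Finset.inter_subset_inter_right (u := X) h
    rw [(hfX _ (heX S)).1, (hfX _ (heX T)).1] at h'
    exact Finset.map_subset_map.1 h'

theorem exists_subset_color_ite_eq (hX : #X = Fintype.card ι) (hAX : Disjoint A X)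
    (hXY : Disjoint X Y) (hc : ¬ HasColoredCopy (monoColoring (Finset ι) a.other) c)
    {p : Finset α → Prop} [DecidablePred p] (hp : Monotone p) :
    ∃ S ⊆ X, c (if p S then A ∪ S ∪ Y else A ∪ S) = a := by
  let f : Finset α → Finset α := fun S => if p S then A ∪ S ∪ Y else A ∪ S
  have hf : Monotone f := by
    intro S T hST
    have hAST : A ∪ S ⊆ A ∪ T := Finset.union_subset_union_right hST
    by_cases hS : p S
    · simpa only [f, if_pos hS, if_pos (hp hST hS)] using Finset.union_subset_union_left hAST
    · by_cases hT : p T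
      · simpa only [f, if_neg hS, if_pos hT] using hAST.trans Finset.subset_union_left
      · simpa only [f, if_neg hS, if_neg hT] using hAST
  have hfX : ∀ S ⊆ X, f S ∩ X = S := by
    intro S hS
    have hlower : A ∪ S ⊆ f S := by
      unfold f
      split_ifs
      exacts [Finset.subset_union_left, subset_rfl]
    have hupper : f S ⊆ A ∪ S ∪ Y := by
      unfold f
      split_ifs
      exacts [subset_rfl, Finset.subset_union_left]
    refine Finset.Subset.antisymm (fun y hy => ?_)
      (Finset.subset_inter (Finset.subset_union_right.trans hlower) hS)
    obtain ⟨hyf, hyX⟩ := Finset.mem_inter.1 hy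
    simpa [Finset.disjoint_right.1 hAX hyX, Finset.disjoint_left.1 hXY hyX] using hupper hyf
  by_contra! hne
  exact hc (hasColoredCopy_mono_iff.2
    ⟨X, hX, f, hf, fun S hS => ⟨hfX S hS, Color.eq_other_of_ne (hne S hS)⟩⟩)

theorem exists_subset_color_eq (hX : #X = Fintype.card ι) (hAX : Disjoint A X)
    (hc : ¬ HasColoredCopy (monoColoring (Finset ι) a.other) c) :
    ∃ S ⊆ X, c (A ∪ S) = a := by
  simpa using exists_subset_color_ite_eq hX hAX (Finset.disjoint_empty_right X) hc
    (p := fun _ => False) monotone_const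

end BooleanLattice

/-- Without monochromatic copies of `Q_n` both colors occur in every `n`-dimensional interval, so
`P` embeds greedily: to place `p`, choose a set of color `cP p` in an interval above the sets
chosen for the elements below `p`. -/
theorem erdosHajnalArrow_finset_sum_prod {ι P : Type*} [Finite ι] [PartialOrder P] [Finite P]
    (cP : P → Color) : ErdosHajnalArrow (Finset (P ⊕ P × ι)) cP (Finset ι) := by
  classical
  cases nonempty_fintype ι
  cases nonempty_fintype P
  intro c
  by_contra! hc
  let A : P → Finset (P ⊕ P × ι) := fun p => {y | y.elim (· ≤ p) (·.1 < p)}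
  let X : P → Finset (P ⊕ P × ι) := fun p => {y | y.elim (fun _ => False) (·.1 = p)}
  have hX : ∀ p, #(X p) = Fintype.card ι := fun p => by
    have : X p = Finset.univ.image fun i => Sum.inr (p, i) := by
      ext (q | ⟨q, i⟩) <;> simp [X, eq_comm]
    rw [this, Finset.card_image_of_injective _ fun i j h => by simpa using h, Finset.card_univ]
  have hAX : ∀ p, Disjoint (A p) (X p) := fun p => by
    rw [Finset.disjoint_left]
    rintro (q | ⟨q, i⟩) <;> simp +contextual [A, X, ne_of_lt]
  have hAXA : ∀ p q, p < q → A p ∪ X p ⊆ A q := by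
    rintro p q hpq (r | ⟨r, i⟩) hr
    · simpa [A] using (show r ≤ p by simpa [A, X] using hr).trans hpq.le
    · simpa [A] using (show r ≤ p by simpa [A, X, le_iff_lt_or_eq] using hr).trans_lt hpq
  choose S hSX hcS using fun p =>
    exists_subset_color_eq (a := cP p) (hX p) (hAX p) (hc.2 _)
  have hle : ∀ p q, A p ∪ S p ⊆ A q ∪ S q ↔ p ≤ q := by
    refine fun p q => ⟨fun h => ?_, fun h => ?_⟩
    · rcases Finset.mem_union.1 (h (Finset.mem_union_left _ (by simp [A] : Sum.inl p ∈ A p)))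
        with hp | hp
      · simpa [A] using hp
      · simpa [X] using hSX q hp
    · rcases h.eq_or_lt with rfl | hlt
      · exact subset_rfl
      · exact ((Finset.union_subset_union_right (hSX p)).trans (hAXA p q hlt)).trans
          Finset.subset_union_left
  exact hc.1 ⟨OrderEmbedding.ofMapLEIff (fun p => A p ∪ S p) hle, hcS⟩

theorem erdosHajnalArrow_posetErdosHajnal {P : Type*} [PartialOrder P] [Finite P] (cP : P → Color)
    (n : ℕ) :
    ErdosHajnalArrow (BooleanLattice (posetErdosHajnal cP n)) cP (BooleanLattice n) := by
  have hne : {N | ErdosHajnalArrow (BooleanLattice N) cP (BooleanLattice n)}.Nonempty :=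
    ⟨_, (erdosHajnalArrow_finset_sum_prod (ι := Fin n) cP).mono
      (Finset.mapEmbedding (Finite.equivFin _).toEmbedding)
      ⟨RelEmbedding.refl _, fun _ => rfl⟩ (RelEmbedding.refl _)⟩
  rw [posetErdosHajnal_eq_sInf]
  exact Nat.sInf_mem hne

section AlternatingChains

/-- The coloring of a chain with `t` elements by alternating colors, starting with `a`. -/
def alternatingChain (a : Color) (t : ℕ) : Fin t → Color :=
  fun i => if Even (i : ℕ) then a else a.other

theorem alternatingChain_zero (a : Color) (t : ℕ) : alternatingChain a (t + 1) 0 = a :=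
  if_pos Even.zero

theorem alternatingChain_succ (a : Color) {t : ℕ} (i : Fin t) :
    alternatingChain a (t + 1) i.succ = alternatingChain a.other t i := by
  cases a <;> by_cases h : Even (i : ℕ) <;>
    simp [alternatingChain, Color.other, h, Nat.even_add_one]

theorem alternatingChain_castSucc_ne_succ (a : Color) {t : ℕ} (i : Fin t) :
    alternatingChain a (t + 1) i.castSucc ≠ alternatingChain a (t + 1) i.succ := by
  cases a <;> by_cases h : Even (i : ℕ) <;>
    simp [alternatingChain, Color.other, h, Nat.even_add_one]

theorem hasColoredCopy_alternatingChain_of_le (a : Color) {s t : ℕ} (h : s ≤ t) :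
    HasColoredCopy (alternatingChain a s) (alternatingChain a t) :=
  ⟨Fin.castLEOrderEmb h, fun _ => rfl⟩

theorem ErdosHajnalArrow.of_alternatingChain_le {Q R : Type*} [PartialOrder Q] [PartialOrder R]
    {a : Color} {s t : ℕ} (h : ErdosHajnalArrow Q (alternatingChain a t) R) (hst : s ≤ t) :
    ErdosHajnalArrow Q (alternatingChain a s) R :=
  h.mono (.refl _) (hasColoredCopy_alternatingChain_of_le a hst) (.refl _)

theorem hasColoredCopy_alternatingChain_of_monotone {Q : Type*} [PartialOrder Q] {c : Q → Color}
    {a : Color} {t : ℕ} {z : Fin (t + 1) → Q} (hz : Monotone z)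
    (hc : ∀ i, c (z i) = alternatingChain a (t + 1) i) :
    HasColoredCopy (alternatingChain a (t + 1)) c := by
  have hstrict : StrictMono z := Fin.strictMono_iff_lt_succ.2 fun i =>
    (hz i.castSucc_lt_succ.le).lt_of_ne fun h =>
      alternatingChain_castSucc_ne_succ a i (by rw [← hc, ← hc, h])
  exact ⟨OrderEmbedding.ofStrictMono z hstrict, hc⟩

variable {α ι : Type*} [Fintype ι] {c : Finset α → Color}

/-- Add all of `Y` to those `S ⊆ X` for which some set between `A` and `A ∪ S` has color `a`. The
resulting copy of `Finset ι` contains a set of color `a`, and this is the top of the triple. -/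
theorem exists_alternating_triple (hc : ∀ a, ¬ HasColoredCopy (monoColoring (Finset ι) a) c)
    (a : Color) {A X Y : Finset α} (hX : #X = Fintype.card ι) (hY : #Y = Fintype.card ι)
    (hAX : Disjoint A X) (hAY : Disjoint A Y) (hXY : Disjoint X Y) :
    ∃ Z₁ Z₂ Z₃, A ⊆ Z₁ ∧ Z₁ ⊆ Z₂ ∧ Z₂ ⊆ Z₃ ∧ c Z₁ = a ∧ c Z₂ = a.other ∧ c Z₃ = a := by
  classical
  let p : Finset α → Prop := fun S => ∃ Z, A ⊆ Z ∧ Z ⊆ A ∪ S ∧ c Z = a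
  have hp : Monotone p := fun S T hST ⟨Z, hAZ, hZS, hZ⟩ =>
    ⟨Z, hAZ, hZS.trans (Finset.union_subset_union_right hST), hZ⟩
  obtain ⟨S, hSX, hS⟩ := exists_subset_color_ite_eq hX hAX hXY (hc a.other) hp
  have hpS : p S := by
    by_contra hpS
    rw [if_neg hpS] at hS
    exact hpS ⟨A ∪ S, Finset.subset_union_left, subset_rfl, hS⟩
  rw [if_pos hpS] at hS
  obtain ⟨Z, hAZ, hZS, hZ⟩ := hpS
  have hASY : Disjoint (A ∪ S) Y := Finset.disjoint_union_left.2 ⟨hAY, hXY.mono_left hSX⟩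
  obtain ⟨T, hTY, hT⟩ := exists_subset_color_eq hY hASY (hc a.other.other)
  exact ⟨Z, A ∪ S ∪ T, A ∪ S ∪ Y, hAZ, hZS.trans Finset.subset_union_left,
    Finset.union_subset_union_right hTY, hZ, hT, hS⟩

theorem exists_monotone_alternating [Fintype α] [DecidableEq α]
    (hc : ∀ a, ¬ HasColoredCopy (monoColoring (Finset ι) a) c) (t : ℕ) (a : Color) (A : Finset α)
    (hA : (t + 2) * Fintype.card ι ≤ #Aᶜ) :
    ∃ z : Fin (t + 3) → Finset α, Monotone z ∧ A ⊆ z 0 ∧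
      ∀ i, c (z i) = alternatingChain a (t + 3) i := by
  induction t generalizing a A with
  | zero =>
    obtain ⟨X, hXA, hX⟩ := Finset.exists_subset_card_eq (show Fintype.card ι ≤ #Aᶜ by lia)
    obtain ⟨Y, hYA, hY⟩ := Finset.exists_subset_card_eq
      (show Fintype.card ι ≤ #(Aᶜ \ X) by rw [Finset.card_sdiff_of_subset hXA]; lia)
    obtain ⟨hYA, hYX⟩ := Finset.subset_sdiff.1 hYA
    obtain ⟨Z₁, Z₂, Z₃, hAZ, h₁₂, h₂₃, h₁, h₂, h₃⟩ := exists_alternating_triple hc a hX hY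
      (Finset.subset_compl_iff_disjoint_left.1 hXA) (Finset.subset_compl_iff_disjoint_left.1 hYA)
      hYX.symm
    refine ⟨![Z₁, Z₂, Z₃], by simp [h₁₂, h₂₃], hAZ, fun i => ?_⟩
    fin_cases i
    exacts [h₁, h₂, h₃]
  | succ t ih =>
    obtain ⟨X, hXA, hX⟩ := Finset.exists_subset_card_eq (show Fintype.card ι ≤ #Aᶜ by lia)
    obtain ⟨S, hSX, hS⟩ := exists_subset_color_eq hX (Finset.subset_compl_iff_disjoint_left.1 hXA)
      (hc a.other)
    obtain ⟨z, hz, hXz, hcz⟩ := ih a.other (A ∪ X) (by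
      rw [Finset.compl_union, ← Finset.sdiff_eq_inter_compl, Finset.card_sdiff_of_subset hXA]
      lia)
    refine ⟨Matrix.vecCons (A ∪ S) z,
      hz.vecCons ((Finset.union_subset_union_right hSX).trans hXz), Finset.subset_union_left,
      Fin.cases ?_ fun i => ?_⟩
    · exact hS.trans (alternatingChain_zero a _).symm
    · exact (hcz i).trans (alternatingChain_succ a i).symm

theorem erdosHajnalArrow_alternatingChain [Fintype α] {t : ℕ}
    (h : (t + 2) * Fintype.card ι ≤ Fintype.card α) (a : Color) :
    ErdosHajnalArrow (Finset α) (alternatingChain a (t + 3)) (Finset ι) := by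
  classical
  intro c
  by_contra! hc
  obtain ⟨z, hz, -, hcz⟩ := exists_monotone_alternating hc.2 t a ∅ (by simpa using h)
  exact hc.1 (hasColoredCopy_alternatingChain_of_monotone hz hcz)

end AlternatingChains

section UpperLowerSets

open Classical in
/-- The coloring in which exactly the elements of `R` are red. -/
noncomputable def redOn {Q : Type*} (R : Set Q) : Q → Color :=
  fun x => if x ∈ R then Color.red else Color.blue

variable {Q : Type*}

theorem redOn_eq_red {R : Set Q} {x : Q} : redOn R x = Color.red ↔ x ∈ R := by
  simp [redOn]

theorem redOn_eq_blue {R : Set Q} {x : Q} : redOn R x = Color.blue ↔ x ∉ R := by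
  simp [redOn]

variable [PartialOrder Q] {U D V : Set Q}

theorem not_hasColoredCopy_redOn (hU : IsUpperSet U) :
    ¬ HasColoredCopy (redAlternatingChain 2) (redOn U) := by
  rintro ⟨φ, hφ⟩
  have h₀ : φ 0 ∈ U := redOn_eq_red.1 (hφ 0)
  have h₁ : φ 1 ∉ U := redOn_eq_blue.1 (hφ 1)
  exact h₁ (hU (φ.monotone (by decide)) h₀)

theorem not_hasColoredCopy_redOn_inter_union (hU : IsUpperSet U) (hD : IsLowerSet D)
    (hV : IsUpperSet V) : ¬ HasColoredCopy (redAlternatingChain 4) (redOn (U ∩ (D ∪ V))) := by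
  rintro ⟨φ, hφ⟩
  have h₀ : φ 0 ∈ U ∩ (D ∪ V) := redOn_eq_red.1 (hφ 0)
  have h₁ : φ 1 ∉ U ∩ (D ∪ V) := redOn_eq_blue.1 (hφ 1)
  have h₂ : φ 2 ∈ U ∩ (D ∪ V) := redOn_eq_red.1 (hφ 2)
  have h₃ : φ 3 ∉ U ∩ (D ∪ V) := redOn_eq_blue.1 (hφ 3)
  have h₁D : φ 1 ∉ D := fun h => h₁ ⟨hU (φ.monotone (by decide)) h₀.1, Or.inl h⟩
  have h₂D : φ 2 ∉ D := fun h => h₁D (hD (φ.monotone (by decide)) h)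
  have h₂₃ : φ 2 ≤ φ 3 := φ.monotone (by decide)
  exact h₃ ⟨hU h₂₃ h₂.1, Or.inr (hV h₂₃ (h₂.2.resolve_left h₂D))⟩

theorem isUpperSet_setOf_le_card {α : Type*} (k : ℕ) : IsUpperSet {Z : Finset α | k ≤ #Z} :=
  fun _ _ hZW hZ => le_trans hZ (Finset.card_le_card hZW)

end UpperLowerSets

theorem two_mul_card_le_of_erdosHajnalArrow {α ι : Type*} [Fintype α] [Fintype ι]
    (h : ErdosHajnalArrow (Finset α) (redAlternatingChain 2) (Finset ι)) :
    2 * Fintype.card ι ≤ Fintype.card α := by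
  classical
  obtain hchain | ⟨_ | _, hcopy⟩ := h (redOn {Z | Fintype.card ι ≤ #Z})
  · exact absurd hchain (not_hasColoredCopy_redOn (isUpperSet_setOf_le_card _))
  · obtain ⟨X, hX, f, -, hf⟩ := hasColoredCopy_mono_iff.1 hcopy
    obtain ⟨hfX, hblue⟩ := hf X subset_rfl
    refine absurd ?_ (redOn_eq_blue.1 hblue)
    exact hX.ge.trans (Finset.card_le_card (Finset.inter_eq_right.1 hfX))
  · obtain ⟨X, hX, f, -, hf⟩ := hasColoredCopy_mono_iff.1 hcopy
    obtain ⟨hfX, hred⟩ := hf ∅ (Finset.empty_subset X)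
    have hcard : Fintype.card ι ≤ #(f ∅) := redOn_eq_red.1 hred
    have hle := Finset.card_le_univ (f ∅ ∪ X)
    rw [Finset.card_union_of_disjoint (Finset.disjoint_iff_inter_eq_empty.2 hfX), hX] at hle
    lia

section SeparatingFamilies

variable {α : Type*} {r d : ℕ} {H : Set (Finset α)}

/-- The coloring of the Boolean lattice of dimension `4r + d` obtained from a family `H` of sets of
size `2r + d`: blue below layer `r`, red above layer `3r + d`, and in between red exactly on the
sets contained in a member of `H`. -/
noncomputable def separatingColoring (r d : ℕ) (H : Set (Finset α)) : Finset α → Color :=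
  redOn ({Z | r ≤ #Z} ∩ (lowerClosure H ∪ {Z | 3 * r + d + 1 ≤ #Z}))

theorem not_hasColoredCopy_separatingColoring (r d : ℕ) (H : Set (Finset α)) :
    ¬ HasColoredCopy (redAlternatingChain 4) (separatingColoring r d H) :=
  not_hasColoredCopy_redOn_inter_union (isUpperSet_setOf_le_card r) (lowerClosure H).lower
    (isUpperSet_setOf_le_card _)

variable [DecidableEq α]

/-- The family `H` separates low from high `2r`-dimensional subcubes `{Z | G ⊆ Z ⊆ G ∪ X}` on
their middle layers: if `#G = r + d` then the middle layer meets `H`, and if `#G = r` then some set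
of the middle layer is contained in no member of `H`. -/
structure IsSeparatingFamily (r d : ℕ) (H : Set (Finset α)) : Prop where
  exists_union_mem : ∀ ⦃G X : Finset α⦄, Disjoint G X → #G = r + d → #X = 2 * r →
    ∃ S ⊆ X, #S = r ∧ G ∪ S ∈ H
  exists_union_notMem_lowerClosure : ∀ ⦃G X : Finset α⦄, Disjoint G X → #G = r → #X = 2 * r →
    ∃ S ⊆ X, #S = r ∧ G ∪ S ∉ lowerClosure H

variable [Fintype α] {ι : Type*} [Fintype ι]

namespace IsSeparatingFamily

theorem not_hasColoredCopy_blue (hH : IsSeparatingFamily r d H)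
    (hα : Fintype.card α = 4 * r + d) (hι : Fintype.card ι = 2 * r) :
    ¬ HasColoredCopy (monoColoring (Finset ι) Color.blue) (separatingColoring r d H) := by
  intro hcopy
  obtain ⟨X, hX, f, hf, hfX⟩ := hasColoredCopy_mono_iff.1 hcopy
  have hblue : ∀ S ⊆ X, r ≤ #(f S) → f S ∉ lowerClosure H ∧ #(f S) ≤ 3 * r + d := by
    intro S hS hr
    simpa [hr, not_or] using redOn_eq_blue.1 (hfX S hS).2
  have hXf : X ⊆ f X := Finset.inter_eq_right.1 (hfX X subset_rfl).1
  have hfXcard : #(f X) ≤ 3 * r + d :=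
    (hblue X subset_rfl (by have := Finset.card_le_card hXf; lia)).2
  obtain ⟨G, hfG, hGX, hG⟩ := Finset.exists_subsuperset_card_eq (n := r + d)
    (show f X \ X ⊆ Xᶜ from fun y hy => by simp_all)
    (by rw [Finset.card_sdiff_of_subset hXf]; lia) (by rw [Finset.card_compl]; lia)
  obtain ⟨S, hSX, hS, hGS⟩ := hH.exists_union_mem
    (Finset.subset_compl_iff_disjoint_right.1 hGX) hG (hX.trans hι)
  have hfS := (hfX S hSX).1
  have hfSG : f S ⊆ G ∪ S := by
    intro y hy
    by_cases hyX : y ∈ X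
    · exact Finset.mem_union_right _ (hfS ▸ Finset.mem_inter.2 ⟨hy, hyX⟩)
    · exact Finset.mem_union_left _ (hfG (Finset.mem_sdiff.2 ⟨hf hSX hy, hyX⟩))
  have hSf : S ⊆ f S := hfS.ge.trans Finset.inter_subset_left
  exact (hblue S hSX (hS.ge.trans (Finset.card_le_card hSf))).1 ⟨_, hGS, hfSG⟩

theorem not_hasColoredCopy_red (hH : IsSeparatingFamily r d H)
    (hα : Fintype.card α = 4 * r + d) (hι : Fintype.card ι = 2 * r) :
    ¬ HasColoredCopy (monoColoring (Finset ι) Color.red) (separatingColoring r d H) := by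
  intro hcopy
  obtain ⟨X, hX, f, hf, hfX⟩ := hasColoredCopy_mono_iff.1 hcopy
  have hred : ∀ S ⊆ X, r ≤ #(f S) ∧ (f S ∈ lowerClosure H ∨ 3 * r + d < #(f S)) :=
    fun S hS => redOn_eq_red.1 (hfX S hS).2
  obtain ⟨G, hGf, hG⟩ := Finset.exists_subset_card_eq (hred ∅ (Finset.empty_subset X)).1
  have hdisj : Disjoint (f ∅) X :=
    Finset.disjoint_iff_inter_eq_empty.2 (hfX ∅ (Finset.empty_subset X)).1
  obtain ⟨S, hSX, hS, hGS⟩ := hH.exists_union_notMem_lowerClosure (hdisj.mono_left hGf) hG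
    (hX.trans hι)
  have hfS := (hfX S hSX).1
  have hSf : S ⊆ f S := hfS.ge.trans Finset.inter_subset_left
  have hGSf : G ∪ S ⊆ f S :=
    Finset.union_subset (hGf.trans (hf (Finset.empty_subset S))) hSf
  have hcard : #(f S) + #(X \ S) ≤ Fintype.card α := by
    rw [← Finset.card_union_of_disjoint]
    · exact Finset.card_le_univ _
    · refine Finset.disjoint_left.2 fun y hy hyX => ?_
      obtain ⟨hyX, hyS⟩ := Finset.mem_sdiff.1 hyX
      exact hyS (hfS ▸ Finset.mem_inter.2 ⟨hy, hyX⟩)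
  rw [Finset.card_sdiff_of_subset hSX] at hcard
  rcases (hred S hSX).2 with h | h
  · exact hGS ((lowerClosure H).lower hGSf h)
  · lia

theorem not_erdosHajnalArrow (hH : IsSeparatingFamily r d H)
    (hα : Fintype.card α = 4 * r + d) (hι : Fintype.card ι = 2 * r) :
    ¬ ErdosHajnalArrow (Finset α) (redAlternatingChain 4) (Finset ι) := by
  intro h
  obtain hchain | ⟨_ | _, hcopy⟩ := h (separatingColoring r d H)
  · exact not_hasColoredCopy_separatingColoring r d H hchain
  · exact hH.not_hasColoredCopy_blue hα hι hcopy
  · exact hH.not_hasColoredCopy_red hα hι hcopy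

end IsSeparatingFamily

end SeparatingFamilies

section RandomSets

variable {L κ : Type*} (p : unitInterval)

theorem setBernoulli_real_superset (K : Finset L) :
    setBer(Set.univ, p).real {H | (K : Set L) ⊆ H} = (p : ℝ) ^ #K := by
  have hpre : (fun q : L → Prop => {z | q z}) ⁻¹' {H | (K : Set L) ⊆ H} =
      Set.pi K fun _ => {True} := by
    ext q
    simp [Set.subset_def]
  rw [measureReal_def, setBernoulli_apply', hpre, Measure.infinitePi_pi _ (by measurability)]
  simp

theorem setBernoulli_real_disjoint (K : Finset L) :
    setBer(Set.univ, p).real {H : Set L | Disjoint ↑K H} = (1 - p : ℝ) ^ #K := by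
  have hpre : (fun q : L → Prop => {z | q z}) ⁻¹' {H : Set L | Disjoint ↑K H} =
      Set.pi K fun _ => {False} := by
    ext q
    simp [Set.disjoint_left]
  rw [measureReal_def, setBernoulli_apply', hpre, Measure.infinitePi_pi _ (by measurability)]
  simp

theorem setBernoulli_real_forall_not_disjoint_le [Fintype κ] {U : κ → Finset L} {D : ℕ}
    (hU : ∀ l, #(U l) ≤ D) (hdisj : Pairwise fun l l' => Disjoint (U l) (U l')) :
    setBer(Set.univ, p).real {H : Set L | ∀ l, ¬ Disjoint (U l : Set L) H} ≤
      (D * p : ℝ) ^ Fintype.card κ := by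
  classical
  have hcover : {H : Set L | ∀ l, ¬ Disjoint (U l : Set L) H} ⊆
      ⋃ u ∈ Fintype.piFinset U, {H | (Finset.univ.image u : Set L) ⊆ H} := by
    intro H hH
    choose u huU huH using fun l => Set.not_disjoint_iff.1 (hH l)
    simp only [Set.mem_iUnion]
    exact ⟨u, Fintype.mem_piFinset.2 huU, by simpa [Set.range_subset_iff] using huH⟩
  have hcard : ∀ u ∈ Fintype.piFinset U, #(Finset.univ.image u) = Fintype.card κ := by
    refine fun u hu => Finset.card_image_of_injective _ fun l l' hll => ?_
    by_contra hne
    have huU := Fintype.mem_piFinset.1 hu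
    exact Finset.disjoint_left.1 (hdisj hne) (huU l) (hll ▸ huU l')
  calc setBer(Set.univ, p).real {H : Set L | ∀ l, ¬ Disjoint (U l : Set L) H}
      ≤ ∑ u ∈ Fintype.piFinset U,
          setBer(Set.univ, p).real {H | (Finset.univ.image u : Set L) ⊆ H} :=
        (measureReal_mono hcover (measure_ne_top _ _)).trans (measureReal_biUnion_finset_le _ _)
    _ = (∏ l, #(U l) : ℕ) * (p : ℝ) ^ Fintype.card κ := by
        rw [Finset.sum_congr rfl fun u hu => by rw [setBernoulli_real_superset, hcard u hu],
          Finset.sum_const, nsmul_eq_mul, Fintype.card_piFinset]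
    _ ≤ (D ^ Fintype.card κ : ℕ) * (p : ℝ) ^ Fintype.card κ := by
        have := p.2.1
        gcongr
        exact Finset.prod_le_pow_card _ _ _ fun l _ => hU l
    _ = (D * p : ℝ) ^ Fintype.card κ := by rw [mul_pow, Nat.cast_pow]

theorem exists_set_not_disjoint_and_disjoint {ι₁ ι₂ : Type*} [Fintype ι₁] [Fintype ι₂]
    [Fintype κ] {s D : ℕ} {I : ι₁ → Finset L} {U : ι₂ → κ → Finset L} (hI : ∀ i, s ≤ #(I i))
    (hU : ∀ j l, #(U j l) ≤ D) (hdisj : ∀ j, Pairwise fun l l' => Disjoint (U j l) (U j l'))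
    (h : Fintype.card ι₁ * (1 - p : ℝ) ^ s + Fintype.card ι₂ * (D * p : ℝ) ^ Fintype.card κ < 1) :
    ∃ H : Set L, (∀ i, ¬ Disjoint (I i : Set L) H) ∧ ∀ j, ∃ l, Disjoint ↑(U j l) H := by
  let B₁ : ι₁ → Set (Set L) := fun i => {H | Disjoint (I i : Set L) H}
  let B₂ : ι₂ → Set (Set L) := fun j => {H | ∀ l, ¬ Disjoint (U j l : Set L) H}
  by_contra! hbad
  have hcover : Set.univ ⊆ (⋃ i, B₁ i) ∪ ⋃ j, B₂ j := by
    intro H _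
    by_cases hH : ∀ i, ¬ Disjoint (I i : Set L) H
    · exact Or.inr (Set.mem_iUnion.2 (hbad H hH))
    · exact Or.inl (Set.mem_iUnion.2 (by simpa [B₁] using hH))
  have hB₁ (i : ι₁) : setBer(Set.univ, p).real (B₁ i) ≤ (1 - p : ℝ) ^ s :=
    (setBernoulli_real_disjoint p (I i)).trans_le
      (pow_le_pow_of_le_one (by linarith [p.2.2]) (by linarith [p.2.1]) (hI i))
  have hB₂ (j : ι₂) : setBer(Set.univ, p).real (B₂ j) ≤ (D * p : ℝ) ^ Fintype.card κ :=
    setBernoulli_real_forall_not_disjoint_le p (hU j) (hdisj j)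
  have htotal := calc
    1 = setBer(Set.univ, p).real Set.univ := by simp
    _ ≤ ∑ i, setBer(Set.univ, p).real (B₁ i) + ∑ j, setBer(Set.univ, p).real (B₂ j) :=
      (measureReal_mono hcover).trans <| (measureReal_union_le _ _).trans <|
        add_le_add (measureReal_iUnion_fintype_le _) (measureReal_iUnion_fintype_le _)
    _ ≤ ∑ _i : ι₁, (1 - p : ℝ) ^ s + ∑ _j : ι₂, (D * p : ℝ) ^ Fintype.card κ :=
      add_le_add (Finset.sum_le_sum fun i _ => hB₁ i) (Finset.sum_le_sum fun j _ => hB₂ j)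
  simp only [Finset.sum_const, Finset.card_univ, nsmul_eq_mul] at htotal
  linarith

end RandomSets

section ExistsSeparatingFamily

variable {α : Type*} [DecidableEq α]

theorem exists_subsets_card_union_eq {κ : Type*} [Fintype κ] {X : Finset α} {a b : ℕ}
    (hX : a + Fintype.card κ * b ≤ #X) :
    ∃ S : κ → Finset α, (∀ l, S l ⊆ X) ∧ (∀ l, #(S l) = a + b) ∧
      Pairwise fun l l' => #(S l ∪ S l') = a + 2 * b := by
  classical
  obtain ⟨e⟩ : Nonempty (Fin a ⊕ κ × Fin b ↪ X) :=
    Function.Embedding.nonempty_of_card_le (by simpa using hX)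
  let petals : Finset κ → Finset α := fun s =>
    ((Finset.univ : Finset (Fin a)).disjSum (s ×ˢ (Finset.univ : Finset (Fin b)))).map
      (e.trans (Function.Embedding.subtype _))
  have hcard : ∀ s, #(petals s) = a + #s * b := fun s => by simp [petals]
  refine ⟨fun l => petals {l}, fun l y hy => ?_, fun l => by simp [hcard], fun l l' hne => ?_⟩
  · obtain ⟨x, -, rfl⟩ := Finset.mem_map.1 hy
    exact Subtype.coe_prop _
  · have hunion : petals {l} ∪ petals {l'} = petals {l, l'} := by
      rw [← Finset.map_union]
      congr 1
      ext (x | ⟨x, y⟩) <;> simp [eq_comm]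
    dsimp only
    rw [hunion, hcard, Finset.card_pair hne]

theorem card_filter_Icc_card_eq {Z W : Finset α} (h : Z ⊆ W) {m : ℕ} (hm : #Z ≤ m) :
    #{T ∈ Finset.Icc Z W | #T = m} = (#W - #Z).choose (m - #Z) := by
  rw [← Finset.card_sdiff_of_subset h, ← Finset.card_powersetCard]
  refine Finset.card_nbij' (· \ Z) (Z ∪ ·) (fun T hT => ?_) (fun S hS => ?_) (fun T hT => ?_)
    fun S hS => ?_
  · simp only [Finset.coe_filter, Finset.mem_Icc, Set.mem_ofPred_eq] at hT
    obtain ⟨⟨hZT, hTW⟩, rfl⟩ := hT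
    exact Finset.mem_powersetCard.2
      ⟨Finset.sdiff_subset_sdiff hTW subset_rfl, Finset.card_sdiff_of_subset hZT⟩
  · obtain ⟨hSW, hS⟩ := Finset.mem_powersetCard.1 hS
    obtain ⟨hSW, hSZ⟩ := Finset.subset_sdiff.1 hSW
    simp only [Finset.coe_filter, Finset.mem_Icc, Set.mem_ofPred_eq]
    refine ⟨⟨Finset.subset_union_left, Finset.union_subset h hSW⟩, ?_⟩
    rw [Finset.card_union_of_disjoint hSZ.symm, hS, Nat.add_sub_cancel' hm]
  · exact Finset.union_sdiff_of_subset (Finset.mem_Icc.1 (Finset.mem_filter.1 hT).1).1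
  · exact Finset.union_sdiff_cancel_left
      (Finset.subset_sdiff.1 (Finset.mem_powersetCard.1 hS).1).2.symm

/-- Take the sets `S l` with pairwise unions of size `r + d + 1`: then no set of size `2r + d`
contains `G ∪ S l` for two different `l`. -/
theorem exists_pairwise_disjoint_filter_Icc [Fintype α] {κ : Type*} [Fintype κ] {r d : ℕ}
    (hdr : d < r) (hκ : Fintype.card κ * (d + 1) ≤ r + d + 1) {G X : Finset α}
    (hGX : Disjoint G X) (hG : #G = r) (hX : #X = 2 * r) :
    ∃ S : κ → Finset α, (∀ l, S l ⊆ X) ∧ (∀ l, #(S l) = r) ∧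
      Pairwise fun l l' => Disjoint {T ∈ Finset.Icc (G ∪ S l) Finset.univ | #T = 2 * r + d}
        {T ∈ Finset.Icc (G ∪ S l') Finset.univ | #T = 2 * r + d} := by
  obtain ⟨S, hSX, hS, hSS⟩ := exists_subsets_card_union_eq (κ := κ) (X := X)
    (a := r - (d + 1)) (b := d + 1) (by lia)
  refine ⟨S, hSX, fun l => by rw [hS]; lia, fun l l' hll => Finset.disjoint_left.2 ?_⟩
  intro T hT hT'
  simp only [Finset.mem_filter, Finset.mem_Icc] at hT hT'
  have hle := Finset.card_le_card (Finset.union_subset hT.1.1 hT'.1.1)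
  have hdisj := hGX.mono_right (Finset.union_subset (hSX l) (hSX l'))
  rw [← Finset.union_union_distrib_left, Finset.card_union_of_disjoint hdisj, hSS hll] at hle
  lia

theorem exists_isSeparatingFamily [Fintype α] (p : unitInterval) {r d k : ℕ}
    (hα : Fintype.card α = 4 * r + d) (hdr : d < r) (hk : k * (d + 1) ≤ r + d + 1)
    (hp : 4 ^ (4 * r + d) * (1 - p : ℝ) ^ (2 * r).choose r +
      4 ^ (4 * r + d) * ((2 * r + d).choose d * p : ℝ) ^ k < 1) :
    ∃ H : Set (Finset α), IsSeparatingFamily r d H := by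
  let Pairs (g : ℕ) := {q : Finset α × Finset α // Disjoint q.1 q.2 ∧ #q.1 = g ∧ #q.2 = 2 * r}
  have hpairs (g : ℕ) : (Fintype.card (Pairs g) : ℝ) ≤ 4 ^ (4 * r + d) := by
    have h := Fintype.card_subtype_le fun q : Finset α × Finset α =>
      Disjoint q.1 q.2 ∧ #q.1 = g ∧ #q.2 = 2 * r
    rw [Fintype.card_prod, Fintype.card_finset, hα, ← mul_pow] at h
    exact_mod_cast h
  choose S hSX hS hdisj using fun q : Pairs r => exists_pairwise_disjoint_filter_Icc (κ := Fin k)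
    hdr (by rwa [Fintype.card_fin]) q.2.1 q.2.2.1 q.2.2.2
  have hGS (q : Pairs r) (l : Fin k) : #(q.1.1 ∪ S q l) = 2 * r := by
    rw [Finset.card_union_of_disjoint (q.2.1.mono_right (hSX q l)), q.2.2.1, hS, two_mul]
  have hI (q : Pairs (r + d)) : (2 * r).choose r ≤
      #{T ∈ Finset.Icc q.1.1 (q.1.1 ∪ q.1.2) | #T = 2 * r + d} := by
    rw [card_filter_Icc_card_eq Finset.subset_union_left (by lia),
      Finset.card_union_of_disjoint q.2.1, q.2.2.1, q.2.2.2, Nat.add_sub_cancel_left,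
      show 2 * r + d - (r + d) = r by lia]
  have hU (q : Pairs r) (l : Fin k) :
      #{T ∈ Finset.Icc (q.1.1 ∪ S q l) Finset.univ | #T = 2 * r + d} ≤ (2 * r + d).choose d := by
    rw [card_filter_Icc_card_eq (Finset.subset_univ _) (by rw [hGS]; lia), hGS, Finset.card_univ,
      hα, show 4 * r + d - 2 * r = 2 * r + d by lia, Nat.add_sub_cancel_left]
  obtain ⟨H, hHI, hHU⟩ := exists_set_not_disjoint_and_disjoint p hI hU hdisj <| by
    have hp₀ := p.2.1
    have hp₁ : 0 ≤ 1 - (p : ℝ) := by linarith [p.2.2]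
    refine lt_of_le_of_lt ?_ hp
    rw [Fintype.card_fin]
    gcongr
    exacts [hpairs _, hpairs _]
  refine ⟨{T ∈ H | #T = 2 * r + d}, ⟨fun G X hGX hG hX => ?_, fun G X hGX hG hX => ?_⟩⟩
  · obtain ⟨T, hT, hTH⟩ := Set.not_disjoint_iff.1 (hHI ⟨(G, X), hGX, hG, hX⟩)
    simp only [Finset.coe_filter, Finset.mem_Icc, Set.mem_ofPred_eq] at hT
    obtain ⟨⟨hGT, hTX⟩, hT⟩ := hT
    refine ⟨T \ G, sdiff_le_iff.2 hTX, ?_, ?_⟩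
    · rw [Finset.card_sdiff_of_subset hGT]
      lia
    · rw [Finset.union_sdiff_of_subset hGT]
      exact ⟨hTH, hT⟩
  · let q : Pairs r := ⟨(G, X), hGX, hG, hX⟩
    obtain ⟨l, hl⟩ := hHU q
    refine ⟨S q l, hSX q l, hS q l, ?_⟩
    rintro ⟨T, ⟨hTH, hT⟩, hGST⟩
    exact Set.disjoint_left.1 hl (by simpa using ⟨hGST, hT⟩) hTH

end ExistsSeparatingFamily

section Asymptotics

theorem choose_thirtyThree_mul_le (m : ℕ) : (33 * m).choose m ≤ 2 ^ (7 * m) := by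
  have hterm : 32 ^ (32 * m) * (33 * m).choose m ≤ 33 ^ (33 * m) := by
    have hbinom : (1 + 32) ^ (33 * m) = ∑ i ∈ Finset.range (33 * m + 1),
        32 ^ (33 * m - i) * (33 * m).choose i :=
      (add_pow 1 32 _).trans (by simp)
    have h := Finset.single_le_sum (f := fun i => 32 ^ (33 * m - i) * (33 * m).choose i)
      (fun _ _ => Nat.zero_le _) (Finset.mem_range.2 (show m < 33 * m + 1 by lia))
    rwa [← hbinom, show 33 * m - m = 32 * m by lia] at h
  have hpow : 33 ^ (33 * m) ≤ 32 ^ (32 * m) * 2 ^ (7 * m) := by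
    rw [pow_mul, pow_mul, pow_mul, ← mul_pow]
    exact Nat.pow_le_pow_left (by norm_num) m
  exact Nat.le_of_mul_le_mul_left (hterm.trans hpow) (by positivity)

theorem mul_two_pow_le_choose {m : ℕ} (hm : 2 ≤ m) :
    200 * m * 2 ^ (20 * m) ≤ (2 * (16 * m)).choose (16 * m) := by
  have hquad : 3200 * m ^ 2 ≤ 2 ^ (12 * m) := calc
    3200 * m ^ 2 ≤ 2 ^ (10 * m) * (2 ^ m) ^ 2 := by
      gcongr
      · calc
          3200 ≤ 2 ^ (10 * 2) := by norm_num
          _ ≤ 2 ^ (10 * m) := by gcongr; norm_num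
      · exact Nat.lt_two_pow_self.le
    _ = 2 ^ (12 * m) := by ring
  have hcentral := Nat.four_pow_lt_mul_centralBinom (16 * m) (by lia)
  rw [Nat.centralBinom_eq_two_mul_choose] at hcentral
  refine Nat.le_of_mul_le_mul_left (?_ : 16 * m * _ ≤ 16 * m * _) (by lia : 0 < 16 * m)
  calc 16 * m * (200 * m * 2 ^ (20 * m)) = 3200 * m ^ 2 * 2 ^ (20 * m) := by ring
    _ ≤ 2 ^ (12 * m) * 2 ^ (20 * m) := by gcongr
    _ = 4 ^ (16 * m) := by
      rw [← pow_add, show (4 : ℕ) = 2 ^ 2 by norm_num, ← pow_mul]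
      ring
    _ ≤ 16 * m * (2 * (16 * m)).choose (16 * m) := hcentral.le

theorem one_sub_pow_le_one_half_pow {p : ℝ} (hp : p ≤ 1) {C s : ℕ} (h : s ≤ p * C) :
    (1 - p) ^ C ≤ (1 / 2) ^ s := by
  have hexp : Real.exp (-1) ≤ 1 / 2 := by
    rw [Real.exp_neg, inv_eq_one_div]
    gcongr
    linarith [Real.add_one_le_exp 1]
  calc (1 - p) ^ C ≤ Real.exp (-p) ^ C :=
        pow_le_pow_left₀ (sub_nonneg.2 hp) (Real.one_sub_le_exp_neg p) C
    _ = Real.exp (-(p * C)) := by rw [← Real.exp_nat_mul]; ring_nf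
    _ ≤ Real.exp (-s) := by gcongr
    _ = Real.exp (-1) ^ s := by rw [← Real.exp_nat_mul]; ring_nf
    _ ≤ (1 / 2) ^ s := by gcongr

theorem exists_isSeparatingFamily_of_card_eq {α : Type*} [Fintype α] [DecidableEq α] {m : ℕ}
    (hm : 2 ≤ m) (hα : Fintype.card α = 65 * m) :
    ∃ H : Set (Finset α), IsSeparatingFamily (16 * m) m H := by
  -- For this `p`, `p * (32m choose 16m)` grows exponentially in `m`, while the eleventh power of
  -- `(33m choose m) * p ≤ 2 ^ (-13m)` is below `4 ^ (-65m)`.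
  let p : unitInterval :=
    ⟨(1 / 2) ^ (20 * m), by positivity, pow_le_one₀ (by norm_num) (by norm_num)⟩
  have hinter : (4 : ℝ) ^ (65 * m) * (1 - p) ^ (2 * (16 * m)).choose (16 * m) ≤
      (1 / 2) ^ (70 * m) := by
    have hmean : ((200 * m : ℕ) : ℝ) ≤ p * (2 * (16 * m)).choose (16 * m) := by
      have h : ((200 * m : ℕ) : ℝ) * 2 ^ (20 * m) ≤ (2 * (16 * m)).choose (16 * m) :=
        mod_cast mul_two_pow_le_choose hm
      calc ((200 * m : ℕ) : ℝ) = p * ((200 * m : ℕ) * 2 ^ (20 * m)) := by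
            simp only [p, one_div, inv_pow]
            field_simp
        _ ≤ p * (2 * (16 * m)).choose (16 * m) := mul_le_mul_of_nonneg_left h p.2.1
    calc (4 : ℝ) ^ (65 * m) * (1 - p) ^ (2 * (16 * m)).choose (16 * m)
        ≤ 4 ^ (65 * m) * (1 / 2) ^ (200 * m) := by
          gcongr
          exact one_sub_pow_le_one_half_pow p.2.2 hmean
      _ = (1 / 2) ^ (70 * m) := by
          simp only [pow_mul, ← mul_pow]
          norm_num
  have hunion : (4 : ℝ) ^ (65 * m) * ((2 * (16 * m) + m).choose m * p) ^ 11 ≤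
      (1 / 2) ^ (13 * m) := by
    have hchoose : ((2 * (16 * m) + m).choose m : ℝ) ≤ 2 ^ (7 * m) := by
      rw [show 2 * (16 * m) + m = 33 * m by ring]
      exact_mod_cast choose_thirtyThree_mul_le m
    calc (4 : ℝ) ^ (65 * m) * ((2 * (16 * m) + m).choose m * p) ^ 11
        ≤ 4 ^ (65 * m) * (2 ^ (7 * m) * (1 / 2) ^ (20 * m)) ^ 11 := by
          gcongr
      _ = (1 / 2) ^ (13 * m) := by
          simp only [pow_mul, ← mul_pow, ← pow_mul _ m 11, mul_comm m 11]
          norm_num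
  refine exists_isSeparatingFamily p (k := 11) (by lia) (by lia) (by lia) ?_
  rw [show 4 * (16 * m) + m = 65 * m by ring]
  have hsmall {j : ℕ} (hj : 2 ≤ j) : (1 / 2 : ℝ) ^ j ≤ 1 / 4 :=
    (pow_le_pow_of_le_one (by norm_num) (by norm_num) hj).trans (by norm_num)
  linarith [hsmall (show 2 ≤ 70 * m by lia), hsmall (show 2 ≤ 13 * m by lia)]

theorem mul_lt_of_erdosHajnalArrow_redAlternatingChain {N n : ℕ} (hn : 6400 ≤ n)
    (h : ErdosHajnalArrow (BooleanLattice N) (redAlternatingChain 4) (BooleanLattice n)) :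
    (2.02 : ℝ) * n < N := by
  by_contra! hN
  obtain ⟨m, hm⟩ : ∃ m, m = n / 32 := ⟨_, rfl⟩
  have hNm : N ≤ 65 * m := by
    have hn' : (n : ℝ) ≤ 32 * m + 31 := by exact_mod_cast (by lia : n ≤ 32 * m + 31)
    have hm' : (200 : ℝ) ≤ m := by exact_mod_cast (by lia : 200 ≤ m)
    exact_mod_cast (by linarith : (N : ℝ) ≤ 65 * m)
  obtain ⟨H, hH⟩ := exists_isSeparatingFamily_of_card_eq (α := Fin (65 * m)) (m := m)
    (by lia) (by simp)
  exact hH.not_erdosHajnalArrow (ι := Fin (32 * m)) (by rw [Fintype.card_fin]; ring)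
    (by rw [Fintype.card_fin]; ring)
    (h.mono (Finset.mapEmbedding (Fin.castLEEmb hNm))
      (hasColoredCopy_alternatingChain_of_le Color.red le_rfl)
      (Finset.mapEmbedding (Fin.castLEEmb (by lia))))

end Asymptotics

theorem mainTheorem3 :
    (∀ n : ℕ,
      posetErdosHajnal (redAlternatingChain 2) n = 2 * n ∧
      posetErdosHajnal (redAlternatingChain 3) n = 2 * n) ∧
    (∃ n₀ : ℕ, ∀ t : ℕ, 4 ≤ t → ∀ n : ℕ, n₀ ≤ n →
      (2.02 : ℝ) * (n : ℝ) < (posetErdosHajnal (redAlternatingChain t) n : ℝ) ∧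
      posetErdosHajnal (redAlternatingChain t) n ≤ (t - 1) * n) ∧
    (∃ n₀ : ℕ, ∀ n : ℕ, n₀ ≤ n →
      (2.02 : ℝ) * (n : ℝ) < (posetRamsey (BooleanLattice n) (BooleanLattice n) : ℝ)) := by
  have hchain (t n : ℕ) :
      ErdosHajnalArrow (BooleanLattice ((t + 2) * n)) (redAlternatingChain (t + 3))
        (BooleanLattice n) :=
    erdosHajnalArrow_alternatingChain (by simp) Color.red
  have hle (t n : ℕ) : posetErdosHajnal (redAlternatingChain (t + 3)) n ≤ (t + 2) * n :=
    posetErdosHajnal_le (hchain t n)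
  have hge {t : ℕ} (ht : 2 ≤ t) (n : ℕ) : 2 * n ≤ posetErdosHajnal (redAlternatingChain t) n := by
    simpa using two_mul_card_le_of_erdosHajnalArrow
      ((erdosHajnalArrow_posetErdosHajnal (redAlternatingChain t) n).of_alternatingChain_le ht)
  refine ⟨fun n => ⟨?_, ?_⟩, ⟨6400, fun t ht n hn => ⟨?_, ?_⟩⟩, 6400, fun n hn => ?_⟩
  · exact le_antisymm (posetErdosHajnal_le ((hchain 0 n).of_alternatingChain_le (by simp)))
      (hge le_rfl n)
  · exact le_antisymm (hle 0 n) (hge (by simp) n)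
  · exact mul_lt_of_erdosHajnalArrow_redAlternatingChain hn
      ((erdosHajnalArrow_posetErdosHajnal _ n).of_alternatingChain_le ht)
  · obtain ⟨s, rfl⟩ := Nat.exists_eq_add_of_le' (show 3 ≤ t by lia)
    exact hle s n
  · rw [posetRamsey_self]
    exact mul_lt_of_erdosHajnalArrow_redAlternatingChain hn
      ((erdosHajnalArrow_posetErdosHajnal _ n).of_monoColoring _)
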